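/- Let $F\colon \mathbb R^n\times\mathbb R^n\to[0,\infty)$, $(p,y)\mapsto F(p,y)$, be a reversible Finsler metric on $\mathbb R^n$ (the tangent spaces being identified with $\mathbb R^n$): $F$ is continuous, it is $C^\infty$ where $y\neq 0$, it satisfies $F(p,\lambda y)=|\lambda|F(p,y)$ for all $\lambda\in\mathbb R$, and for all $p$ and all $y\ne 0$ the matrix $\big(\frac{\partial^2 F^2}{\partial y^i\partial y^j}(p,y)\big)$ is positive definite. Let $$\varrho^F(a,b)=\inf_x\int_\alpha^\beta F(x(t),\dot x(t))\,dt,$$ where the infimum is over all $C^1$ curves $x\colon[\alpha,\beta]\to\mathbb R^n$ from $a$ to $b$, and let $S_a(r)=\{q\in\mathbb R^n\mid \varrho^F(a,q)=r\}$ be the geodesic sphere with center $a$ and radius $r$. A geodesic (parametrized by arc length) is a map $g\colon I\to\mathbb R^n$ on an interval $I$ such that each $t\in I$ has a neighbourhood in $I$ on which $\varrho^F(g(t_1),g(t_2))=|t_2-t_1|$. Suppose that $F$ is projectively flat, i.e. that each geodesic lies on a straight line of $\mathbb R^n$, and that every geodesic sphere is symmetric about its center in the Euclidean sense, i.e. that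 for all $a\in\mathbb R^n$ and $r>0$ the point reflection $q\mapsto 2a-q$ maps $S_a(r)$ onto itself. Then $(\mathbb R^n,F)$ is a Minkowski space, i.e. $F(p,y)=F(q,y)$ for all $p,q,y\in\mathbb R^n$. -/

import Mathlib

namespace Finsler

open Set
open scoped ContDiff

/-- A reversible Finsler metric on `ℝⁿ`. All tangent spaces of `ℝⁿ` are identified with `ℝⁿ`, and
`F p y` is the Finsler norm of the tangent vector `y` at the point `p`. -/
structure IsReversibleMetric {n : ℕ}
    (F : EuclideanSpace ℝ (Fin n) → EuclideanSpace ℝ (Fin n) → ℝ) : Prop where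
  nonneg : ∀ p y, 0 ≤ F p y
  continuous : Continuous (Function.uncurry F)
  smooth : ContDiffOn ℝ ∞ (Function.uncurry F) {z | z.2 ≠ 0}
  homogeneous : ∀ p (c : ℝ) y, F p (c • y) = |c| * F p y
  /-- The Hessian of `y ↦ F(p, y)²` is positive definite at each nonzero `y`. -/
  hessian_pos : ∀ p y, y ≠ 0 → ∀ v, v ≠ 0 →
    0 < fderiv ℝ (fderiv ℝ (fun u => F p u ^ 2)) y v v

/-- The Finsler arc length of the curve `x` over `[α, β]`. -/
noncomputable def arcLength {n : ℕ}
    (F : EuclideanSpace ℝ (Fin n) → EuclideanSpace ℝ (Fin n) → ℝ)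
    (x : ℝ → EuclideanSpace ℝ (Fin n)) (α β : ℝ) : ℝ :=
  ∫ t in α..β, F (x t) (deriv x t)

/-- The Finsler distance: the infimum of the lengths of the `C¹` curves from `a` to `b`. (A `C¹`
curve on `[α, β]` extends to a `C¹` curve on `ℝ`, and it is allowed to have zero velocity.) -/
noncomputable def finslerDist {n : ℕ}
    (F : EuclideanSpace ℝ (Fin n) → EuclideanSpace ℝ (Fin n) → ℝ)
    (a b : EuclideanSpace ℝ (Fin n)) : ℝ :=
  sInf {L : ℝ | ∃ (x : ℝ → EuclideanSpace ℝ (Fin n)) (α β : ℝ), α ≤ β ∧ ContDiff ℝ 1 x ∧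
    x α = a ∧ x β = b ∧ arcLength F x α β = L}

/-- The geodesic sphere with center `a` and radius `r`. -/
def geodesicSphere {n : ℕ}
    (F : EuclideanSpace ℝ (Fin n) → EuclideanSpace ℝ (Fin n) → ℝ)
    (a : EuclideanSpace ℝ (Fin n)) (r : ℝ) : Set (EuclideanSpace ℝ (Fin n)) :=
  {q | finslerDist F a q = r}

/-- `g` is a geodesic, parametrized by arc length, on the interval `I` (of any kind): it is locally
a shortest curve, that is, near each parameter the Finsler distance of two points of the curve is
the difference of their parameters. -/
def IsGeodesic {n : ℕ}
    (F : EuclideanSpace ℝ (Fin n) → EuclideanSpace ℝ (Fin n) → ℝ)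
    (g : ℝ → EuclideanSpace ℝ (Fin n)) (I : Set ℝ) : Prop :=
  I.OrdConnected ∧ ∀ t ∈ I, ∃ ε > 0, ∀ t₁ ∈ I ∩ Metric.ball t ε, ∀ t₂ ∈ I ∩ Metric.ball t ε,
    finslerDist F (g t₁) (g t₂) = |t₂ - t₁|

/-- Projective flatness of a Finsler metric on `ℝⁿ`: the geodesics are straight. -/
def IsProjectivelyFlat {n : ℕ}
    (F : EuclideanSpace ℝ (Fin n) → EuclideanSpace ℝ (Fin n) → ℝ) : Prop :=
  ∀ (g : ℝ → EuclideanSpace ℝ (Fin n)) (I : Set ℝ), IsGeodesic F g I → Collinear ℝ (g '' I)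

/-- Each geodesic sphere is mapped onto itself by the Euclidean point reflection `q ↦ 2a - q` in its
center `a`. -/
def HasSymmetricSpheres {n : ℕ}
    (F : EuclideanSpace ℝ (Fin n) → EuclideanSpace ℝ (Fin n) → ℝ) : Prop :=
  ∀ (a : EuclideanSpace ℝ (Fin n)) (r : ℝ), 0 < r →
    Equiv.pointReflection a '' geodesicSphere F a r = geodesicSphere F a r

/-- `(ℝⁿ, F)` is a (reversible) Minkowski space: the Finsler norm is the same at all points. -/
structure IsMinkowskiSpace {n : ℕ}
    (F : EuclideanSpace ℝ (Fin n) → EuclideanSpace ℝ (Fin n) → ℝ) : Prop where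
  metric : IsReversibleMetric F
  indep : ∀ p q y, F p y = F q y

end Finsler

namespace Finsler

open Set Filter Topology MeasureTheory
open scoped ContDiff

variable {n : ℕ} {F : EuclideanSpace ℝ (Fin n) → EuclideanSpace ℝ (Fin n) → ℝ}

/-! The two hypotheses make the distance locally equal to the norm: `finslerDist F a b = F a (b -
a)` for `a`, `b` near a given point. Indeed, nearby points are joined by a minimal geodesic. It is
straight, hence passes through the Euclidean midpoint `m` (`exists_midpoint_additive`), and the
symmetry of the spheres about `m` makes its two halves equally long. So halving `b - a` halves the
distance from `a`. Iterating, and using that the distance from `a` is infinitesimally `F a`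
(`tendsto_finslerDist_div`), gives the formula (`exists_finslerDist_eq`).

The triangle inequality for `p - s • y`, `p + t • z`, `p + s • y` then says that `F (p + t • z) (s •
y + t • z) + F (p + t • z) (s • y - t • z)` is minimal at `t = 0`. In its derivative there the
variations of the second argument cancel, so the derivative of `F` in the base point vanishes
(`hasDerivAt_base`) and `F` is constant along lines of base points. -/

lemma hasDerivAt_apply_line {E : Type*} [NormedAddCommGroup E] [NormedSpace ℝ E]
    (f : E → E →L[ℝ] ℝ) (y w : E) {t : ℝ} (h : DifferentiableAt ℝ f (y + t • w)) :
    HasDerivAt (fun t : ℝ => f (y + t • w) w) (fderiv ℝ f (y + t • w) w w) t := by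
  have h2 : HasDerivAt (fun t : ℝ => y + t • w) w t := by
    simpa using ((hasDerivAt_id t).smul_const w).const_add y
  exact (ContinuousLinearMap.apply ℝ ℝ w).hasFDerivAt.comp_hasDerivAt t
    (h.hasFDerivAt.comp_hasDerivAt t h2)

/-! ### Convexity and comparison of the norms `F p` -/

namespace IsReversibleMetric

lemma map_zero (hF : IsReversibleMetric F) (p : EuclideanSpace ℝ (Fin n)) : F p 0 = 0 := by
  simpa using hF.homogeneous p 0 0

lemma map_neg (hF : IsReversibleMetric F) (p y : EuclideanSpace ℝ (Fin n)) :
    F p (-y) = F p y := by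
  simpa using hF.homogeneous p (-1) y

lemma contDiffAt (hF : IsReversibleMetric F) (p : EuclideanSpace ℝ (Fin n))
    {y : EuclideanSpace ℝ (Fin n)} (hy : y ≠ 0) :
    ContDiffAt ℝ ∞ (Function.uncurry F) (p, y) :=
  hF.smooth.contDiffAt ((isOpen_ne_fun continuous_snd continuous_const).mem_nhds hy)

lemma contDiffAt_sq (hF : IsReversibleMetric F) (p : EuclideanSpace ℝ (Fin n))
    {y : EuclideanSpace ℝ (Fin n)} (hy : y ≠ 0) :
    ContDiffAt ℝ 2 (fun u => F p u ^ 2) y := by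
  have h : ContDiffAt ℝ ∞ (fun u => Function.uncurry F (p, u)) y :=
    (hF.contDiffAt p hy).comp y (contDiffAt_const.prodMk contDiffAt_id)
  exact_mod_cast contDiffAt_infty.1 (h.pow 2) 2

lemma hasDerivAt_sq_line (hF : IsReversibleMetric F) (p y w : EuclideanSpace ℝ (Fin n)) {t : ℝ}
    (h : y + t • w ≠ 0) :
    HasDerivAt (fun t : ℝ => F p (y + t • w) ^ 2)
      (fderiv ℝ (fun u => F p u ^ 2) (y + t • w) w) t := by
  have h1 := ((hF.contDiffAt_sq p h).differentiableAt (by norm_num)).hasFDerivAt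
  have h2 : HasDerivAt (fun t : ℝ => y + t • w) w t := by
    simpa using ((hasDerivAt_id t).smul_const w).const_add y
  exact h1.comp_hasDerivAt t h2

lemma hasDerivAt_fderiv_sq_line (hF : IsReversibleMetric F)
    (p y w : EuclideanSpace ℝ (Fin n)) {t : ℝ} (h : y + t • w ≠ 0) :
    HasDerivAt (fun t : ℝ => fderiv ℝ (fun u => F p u ^ 2) (y + t • w) w)
      (fderiv ℝ (fderiv ℝ (fun u => F p u ^ 2)) (y + t • w) w w) t :=
  hasDerivAt_apply_line _ y w <| ContDiffAt.differentiableAt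
    (ContDiffAt.fderiv_right (hF.contDiffAt_sq p h) (by norm_num)) one_ne_zero

/-- If `F p y` vanished, so would `F p ^ 2` on the whole line through `0` and `y`, against the
positive Hessian in the direction `y`. -/
lemma pos (hF : IsReversibleMetric F) (p : EuclideanSpace ℝ (Fin n))
    {y : EuclideanSpace ℝ (Fin n)} (hy : y ≠ 0) : 0 < F p y := by
  refine (hF.nonneg p y).lt_of_ne' fun h0 => ?_
  have hne : ∀ᶠ t : ℝ in 𝓝 0, y + t • y ≠ 0 := by
    have : Continuous fun t : ℝ => y + t • y := by fun_prop
    exact this.continuousAt.eventually_ne (by simpa using hy)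
  have hz : ∀ t : ℝ, F p (y + t • y) ^ 2 = 0 := fun t => by
    have : y + t • y = (1 + t) • y := by rw [add_smul, one_smul]
    rw [this, hF.homogeneous, h0]; simp
  have hd : (fun t : ℝ => fderiv ℝ (fun u => F p u ^ 2) (y + t • y) y) =ᶠ[𝓝 0] fun _ => 0 := by
    filter_upwards [hne] with t ht
    have h := hF.hasDerivAt_sq_line p y y ht
    simp only [hz] at h
    exact h.unique (hasDerivAt_const t 0)
  have h1 := hF.hasDerivAt_fderiv_sq_line p y y hne.self_of_nhds
  have h2 := h1.unique ((hasDerivAt_const (0 : ℝ) (0 : ℝ)).congr_of_eventuallyEq hd)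
  have h3 := hF.hessian_pos p y hy y hy
  rw [zero_smul, add_zero] at h2
  exact h3.ne' h2

lemma fderiv_sq_self (hF : IsReversibleMetric F) (p : EuclideanSpace ℝ (Fin n))
    {v : EuclideanSpace ℝ (Fin n)} (hv : v ≠ 0) :
    fderiv ℝ (fun u => F p u ^ 2) v v = 2 * F p v ^ 2 := by
  have h := hF.hasDerivAt_sq_line p v v (t := 0) (by simpa using hv)
  have h2 : HasDerivAt (fun t : ℝ => (1 + t) ^ 2 * F p v ^ 2)
      (2 * F p v ^ 2) (0 : ℝ) := by
    have := ((((hasDerivAt_id (0 : ℝ)).const_add 1).pow 2).mul_const (F p v ^ 2))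
    simpa using this
  have h3 : (fun t : ℝ => F p (v + t • v) ^ 2) = fun t : ℝ => (1 + t) ^ 2 * F p v ^ 2 := by
    funext t
    have : v + t • v = (1 + t) • v := by rw [add_smul, one_smul]
    rw [this, hF.homogeneous, mul_pow, sq_abs]
  rw [h3] at h
  simpa using h.unique h2

/-- The gradient inequality for the convex function `F(p, ·)²`. -/
lemma fderiv_sq_le (hF : IsReversibleMetric F) (p : EuclideanSpace ℝ (Fin n))
    {v : EuclideanSpace ℝ (Fin n)} (hv : v ≠ 0) (w : EuclideanSpace ℝ (Fin n)) :
    fderiv ℝ (fun u => F p u ^ 2) v w ≤ F p v ^ 2 + F p w ^ 2 := by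
  by_cases hseg : ∃ t ∈ Icc (0 : ℝ) 1, v + t • (w - v) = 0
  -- `F p ^ 2` need not be smooth at `0`. If the segment from `v` to `w` meets `0`, then `w` is a
  -- nonpositive multiple of `v` and the left side is nonpositive.
  · obtain ⟨t, ht, h0⟩ := hseg
    have ht0 : t ≠ 0 := by rintro rfl; simp [hv] at h0
    have ht' : 0 < t := lt_of_le_of_ne ht.1 ht0.symm
    have hw : w = (-((1 - t) / t)) • v := by
      have h1 : t • w = (-(1 - t)) • v := by
        rw [← sub_eq_zero, ← h0]; module
      rw [← inv_smul_smul₀ ht0 w, h1, smul_smul]; congr 1; field_simp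
    have h2 : fderiv ℝ (fun u => F p u ^ 2) v w ≤ 0 := by
      rw [hw, map_smul, hF.fderiv_sq_self p hv, smul_eq_mul]
      have : 0 ≤ (1 - t) / t := div_nonneg (by linarith [ht.2]) ht'.le
      nlinarith [mul_nonneg this (sq_nonneg (F p v))]
    nlinarith [sq_nonneg (F p v), sq_nonneg (F p w)]
  · push Not at hseg
    set g' : ℝ → ℝ := fun t => fderiv ℝ (fun u => F p u ^ 2) (v + t • (w - v)) (w - v) with hg'
    have hd : ∀ t ∈ Icc (0 : ℝ) 1, HasDerivAt (fun t : ℝ => F p (v + t • (w - v)) ^ 2) (g' t) t :=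
      fun t ht => hF.hasDerivAt_sq_line p v (w - v) (hseg t ht)
    have hdd := fun t ht => hF.hasDerivAt_fderiv_sq_line p v (w - v) (t := t) (hseg t ht)
    have hmono : MonotoneOn g' (Icc 0 1) := by
      refine monotoneOn_of_deriv_nonneg (convex_Icc 0 1)
        (fun t ht => (hdd t ht).continuousAt.continuousWithinAt)
        (fun t ht => (hdd t (interior_subset ht)).differentiableAt.differentiableWithinAt)
        fun t ht => ?_
      rw [(hdd t (interior_subset ht)).deriv]
      by_cases hwv : w - v = 0
      · simp [hwv]
      · exact (hF.hessian_pos p _ (hseg t (interior_subset ht)) _ hwv).le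
    obtain ⟨ξ, hξ, hξ'⟩ := exists_hasDerivAt_eq_slope (fun t : ℝ => F p (v + t • (w - v)) ^ 2) g'
      (zero_lt_one) (fun t ht => (hd t ht).continuousAt.continuousWithinAt)
      (fun t ht => hd t (Ioo_subset_Icc_self ht))
    have h1 := hmono (left_mem_Icc.2 zero_le_one) (Ioo_subset_Icc_self hξ) hξ.1.le
    rw [hξ'] at h1
    simp only [hg', zero_smul, add_zero, one_smul, add_sub_cancel, sub_zero, div_one, map_sub,
      hF.fderiv_sq_self p hv] at h1
    linarith

/-- `F(p, ·)` has a supporting linear functional at each nonzero vector. -/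
lemma exists_support (hF : IsReversibleMetric F) (p : EuclideanSpace ℝ (Fin n))
    {v : EuclideanSpace ℝ (Fin n)} (hv : v ≠ 0) :
    ∃ l : EuclideanSpace ℝ (Fin n) →L[ℝ] ℝ, l v = F p v ∧ ∀ w, l w ≤ F p w := by
  have hv0 := hF.pos p hv
  -- This is the differential of `F p` itself at `v`.
  refine ⟨(2 * F p v)⁻¹ • fderiv ℝ (fun u => F p u ^ 2) v, ?_, fun w => ?_⟩
  · simp only [FunLike.coe_smul, Pi.smul_apply, hF.fderiv_sq_self p hv, smul_eq_mul]
    field_simp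
  · rcases eq_or_ne w 0 with rfl | hw
    · simp [hF.map_zero]
    have hw0 := hF.pos p hw
    -- Rescaling `w` to the `F p`-length of `v` makes the bound in the gradient inequality `2 * F p
    -- v ^ 2`.
    have h := hF.fderiv_sq_le p hv ((F p v / F p w) • w)
    rw [map_smul, hF.homogeneous, abs_of_pos (div_pos hv0 hw0), div_mul_cancel₀ _ hw0.ne',
      smul_eq_mul, div_mul_eq_mul_div, div_le_iff₀ hw0] at h
    simp only [FunLike.coe_smul, Pi.smul_apply, smul_eq_mul]
    rw [inv_mul_le_iff₀ (by positivity)]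
    nlinarith

lemma exists_bounds (hF : IsReversibleMetric F) (p : EuclideanSpace ℝ (Fin n)) (R : ℝ) :
    ∃ c > 0, ∃ C > 0, ∀ q ∈ Metric.closedBall p R, ∀ w, c * ‖w‖ ≤ F q w ∧ F q w ≤ C * ‖w‖ := by
  have hK : IsCompact (Metric.closedBall p R ×ˢ Metric.sphere (0 : EuclideanSpace ℝ (Fin n)) 1) :=
    (isCompact_closedBall p R).prod (isCompact_sphere 0 1)
  obtain ⟨c, hc, hc'⟩ := hK.exists_forall_le' (a := 0) hF.continuous.continuousOn
    (fun z hz => hF.pos z.1 (ne_zero_of_mem_unit_sphere ⟨z.2, hz.2⟩))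
  obtain ⟨C, hC⟩ := hK.bddAbove_image hF.continuous.continuousOn
  refine ⟨c, hc, max C 1, by positivity, fun q hq w => ?_⟩
  rcases eq_or_ne w 0 with rfl | hw
  · simp [hF.map_zero]
  have hw' : 0 < ‖w‖ := norm_pos_iff.2 hw
  have hm : (q, ‖w‖⁻¹ • w) ∈
      Metric.closedBall p R ×ˢ Metric.sphere (0 : EuclideanSpace ℝ (Fin n)) 1 :=
    ⟨hq, by simp [norm_smul, hw'.ne']⟩
  have he : F q w = F q (‖w‖⁻¹ • w) * ‖w‖ := by
    rw [hF.homogeneous, abs_of_pos (inv_pos.2 hw')]; field_simp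
  rw [he]
  exact ⟨mul_le_mul_of_nonneg_right (hc' _ hm) hw'.le, mul_le_mul_of_nonneg_right
    ((hC (mem_image_of_mem _ hm)).trans (le_max_left _ _)) hw'.le⟩

lemma eventually_near (hF : IsReversibleMetric F) (p : EuclideanSpace ℝ (Fin n)) {ε : ℝ}
    (hε : 0 < ε) :
    ∀ᶠ q in 𝓝 p, ∀ w, (1 - ε) * F p w ≤ F q w ∧ F q w ≤ (1 + ε) * F p w := by
  have h : ∀ᶠ q in 𝓝 p, ∀ w ∈ Metric.sphere (0 : EuclideanSpace ℝ (Fin n)) 1,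
      (1 - ε) * F p w < F q w ∧ F q w < (1 + ε) * F p w := by
    refine (isCompact_sphere _ _).eventually_forall_of_forall_eventually fun w hw => ?_
    have hw0 := hF.pos p (ne_zero_of_mem_unit_sphere ⟨w, hw⟩)
    have h1 : Continuous fun z : EuclideanSpace ℝ (Fin n) × EuclideanSpace ℝ (Fin n) =>
      F z.1 z.2 := hF.continuous
    have h2 : Continuous fun z : EuclideanSpace ℝ (Fin n) × EuclideanSpace ℝ (Fin n) =>
      F p z.2 := h1.comp (continuous_const.prodMk continuous_snd)
    exact ((continuous_const.mul h2).continuousAt.eventually_lt h1.continuousAt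
      (by simp only [Pi.mul_apply]; nlinarith)).and (h1.continuousAt.eventually_lt
        (continuous_const.mul h2).continuousAt (by simp only; nlinarith))
  filter_upwards [h] with q hq w
  rcases eq_or_ne w 0 with rfl | hw
  · simp [hF.map_zero]
  have hw' : 0 < ‖w‖ := norm_pos_iff.2 hw
  have he : ∀ q, F q w = F q (‖w‖⁻¹ • w) * ‖w‖ := fun q => by
    rw [hF.homogeneous, abs_of_pos (inv_pos.2 hw')]; field_simp
  obtain ⟨h1, h2⟩ := hq (‖w‖⁻¹ • w) (by simp [norm_smul, hw'.ne'])
  rw [he q, he p, ← mul_assoc, ← mul_assoc]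
  exact ⟨mul_le_mul_of_nonneg_right h1.le hw'.le, mul_le_mul_of_nonneg_right h2.le hw'.le⟩

end IsReversibleMetric

/-! ### Arc length and the distance as a continuous pseudometric -/

variable {x : ℝ → EuclideanSpace ℝ (Fin n)} {a b : EuclideanSpace ℝ (Fin n)} {α β : ℝ}

namespace IsReversibleMetric

lemma continuous_speed (hF : IsReversibleMetric F) (hx : ContDiff ℝ 1 x) :
    Continuous fun t => F (x t) (deriv x t) :=
  hF.continuous.comp (hx.continuous.prodMk (hx.continuous_deriv le_rfl))

lemma arcLength_nonneg (hF : IsReversibleMetric F) (h : α ≤ β) : 0 ≤ arcLength F x α β :=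
  intervalIntegral.integral_nonneg h fun _ _ => hF.nonneg _ _

lemma arcLength_add (hF : IsReversibleMetric F) (hx : ContDiff ℝ 1 x) (r s t : ℝ) :
    arcLength F x r s + arcLength F x s t = arcLength F x r t :=
  intervalIntegral.integral_add_adjacent_intervals
    ((hF.continuous_speed hx).intervalIntegrable _ _)
    ((hF.continuous_speed hx).intervalIntegrable _ _)

lemma finslerDist_nonneg (hF : IsReversibleMetric F) (a b : EuclideanSpace ℝ (Fin n)) :
    0 ≤ finslerDist F a b :=
  Real.sInf_nonneg fun _ ⟨_, _, _, h, _, _, _, hL⟩ => hL ▸ hF.arcLength_nonneg h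

lemma finslerDist_le_arcLength (hF : IsReversibleMetric F) (hx : ContDiff ℝ 1 x) (h : α ≤ β) :
    finslerDist F (x α) (x β) ≤ arcLength F x α β :=
  csInf_le ⟨0, fun _ ⟨_, _, _, h, _, _, _, hL⟩ => hL ▸ hF.arcLength_nonneg h⟩
    ⟨x, α, β, h, hx, rfl, rfl, rfl⟩

lemma finslerDist_self (hF : IsReversibleMetric F) (a : EuclideanSpace ℝ (Fin n)) :
    finslerDist F a a = 0 := by
  refine le_antisymm ?_ (hF.finslerDist_nonneg a a)
  simpa [arcLength] using
    hF.finslerDist_le_arcLength (x := fun _ => a) (α := 0) (β := 0) contDiff_const le_rfl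

end IsReversibleMetric

lemma contDiff_line (a v : EuclideanSpace ℝ (Fin n)) : ContDiff ℝ 1 fun t : ℝ => a + t • v := by
  fun_prop

lemma deriv_line (a v : EuclideanSpace ℝ (Fin n)) (t : ℝ) :
    deriv (fun t : ℝ => a + t • v) t = v := by
  have h : HasDerivAt (fun t : ℝ => a + t • v) v t := by
    simpa using ((hasDerivAt_id t).smul_const v).const_add a
  exact h.deriv

lemma exists_curve_of_finslerDist_lt {L : ℝ} (h : finslerDist F a b < L) :
    ∃ (x : ℝ → EuclideanSpace ℝ (Fin n)) (α β : ℝ), α ≤ β ∧ ContDiff ℝ 1 x ∧ x α = a ∧ x β = b ∧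
      arcLength F x α β < L := by
  obtain ⟨_, ⟨x, α, β, h1, h2, h3, h4, rfl⟩, hL⟩ := exists_lt_of_csInf_lt (by
    exact ⟨_, fun t : ℝ => a + t • (b - a), 0, 1, zero_le_one, contDiff_line _ _,
      by simp, by simp, rfl⟩) h
  exact ⟨x, α, β, h1, h2, h3, h4, hL⟩

/-- The open interval suffices: equality near a point fixes the derivative there, and the endpoints
are null. -/
lemma arcLength_congr {y : ℝ → EuclideanSpace ℝ (Fin n)} (h : α ≤ β) (hxy : EqOn x y (Ioo α β)) :
    arcLength F x α β = arcLength F y α β := by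
  unfold arcLength
  rw [intervalIntegral.integral_of_le h, intervalIntegral.integral_of_le h,
    integral_Ioc_eq_integral_Ioo, integral_Ioc_eq_integral_Ioo]
  refine setIntegral_congr_fun measurableSet_Ioo fun t ht => ?_
  simp only [hxy ht, (hxy.eventuallyEq_of_mem (isOpen_Ioo.mem_nhds ht)).deriv_eq]

namespace IsReversibleMetric

lemma arcLength_comp (hF : IsReversibleMetric F) (hx : ContDiff ℝ 1 x) {θ : ℝ → ℝ}
    (hθ : ContDiff ℝ 1 θ) (hmono : Monotone θ) (s t : ℝ) :
    arcLength F (x ∘ θ) s t = arcLength F x (θ s) (θ t) := by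
  have hd : ∀ u, HasDerivAt θ (deriv θ u) u := fun u =>
    (hθ.differentiable one_ne_zero u).hasDerivAt
  unfold arcLength
  rw [← intervalIntegral.integral_comp_mul_deriv (fun u _ => hd u)
    (hθ.continuous_deriv le_rfl).continuousOn (hF.continuous_speed hx)]
  refine intervalIntegral.integral_congr fun u _ => ?_
  have h1 := ((hx.differentiable one_ne_zero (θ u)).hasDerivAt.scomp u (hd u)).deriv
  simp only [Function.comp_apply, h1, hF.homogeneous, abs_of_nonneg hmono.deriv_nonneg]
  ring

/-- Near-minimizing curves can be taken constant outside `[0, 1]`. -/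
lemma exists_stationary_curve (hF : IsReversibleMetric F) {L : ℝ} (h : finslerDist F a b < L) :
    ∃ x : ℝ → EuclideanSpace ℝ (Fin n), ContDiff ℝ 1 x ∧ (∀ t ≤ 0, x t = a) ∧ (∀ t ≥ 1, x t = b) ∧
      arcLength F x 0 1 < L := by
  obtain ⟨x, α, β, hαβ, hx, rfl, rfl, hL⟩ := exists_curve_of_finslerDist_lt h
  have hθ : ContDiff ℝ 1 fun t : ℝ => α + Real.smoothTransition t * (β - α) :=
    contDiff_const.add (Real.smoothTransition.contDiff.mul contDiff_const)
  have hm : Monotone fun t : ℝ => α + Real.smoothTransition t * (β - α) := fun s t hst => by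
    have := mul_le_mul_of_nonneg_right (Real.smoothTransition.monotone hst) (sub_nonneg.2 hαβ)
    simpa using this
  refine ⟨_, hx.comp hθ, fun t ht => ?_, fun t ht => ?_, ?_⟩
  · simp [Real.smoothTransition.zero_of_nonpos ht]
  · simp [Real.smoothTransition.one_of_one_le ht]
  · rw [hF.arcLength_comp hx hθ hm]
    simpa using hL

lemma finslerDist_triangle (hF : IsReversibleMetric F) (a b c : EuclideanSpace ℝ (Fin n)) :
    finslerDist F a c ≤ finslerDist F a b + finslerDist F b c := by
  refine le_of_forall_pos_le_add fun ε hε => ?_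
  obtain ⟨x, hx, hx0, hx1, hxL⟩ := hF.exists_stationary_curve
    (lt_add_of_pos_right (finslerDist F a b) (half_pos hε))
  obtain ⟨y, hy, hy0, hy1, hyL⟩ := hF.exists_stationary_curve
    (lt_add_of_pos_right (finslerDist F b c) (half_pos hε))
  have hs : ContDiff ℝ 1 fun t : ℝ => t - 1 := by fun_prop
  -- Both curves are constant outside `[0, 1]`, so adding the delayed displacement of the second to
  -- the first concatenates them without a corner.
  have hz : ContDiff ℝ 1 fun t => x t + (y (t - 1) - b) :=
    hx.add ((hy.comp hs).sub contDiff_const)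
  have h1 := hF.finslerDist_le_arcLength hz (zero_le_two (α := ℝ))
  rw [← hF.arcLength_add hz 0 1 2, arcLength_congr (y := x) zero_le_one fun t ht => by
      simp [hy0 (t - 1) (by linarith [ht.2])],
    arcLength_congr (x := fun t => x t + (y (t - 1) - b)) (y := y ∘ fun t => t - 1)
      one_le_two fun t ht => by simp [hx1 t ht.1.le],
    hF.arcLength_comp hy hs fun _ _ h => sub_le_sub_right h 1] at h1
  norm_num [hx0 0 le_rfl, hx1 2 one_le_two, hy0 (-1) (by norm_num), hy1 1 le_rfl] at h1
  linarith

lemma finslerDist_comm_le (hF : IsReversibleMetric F) (a b : EuclideanSpace ℝ (Fin n)) :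
    finslerDist F b a ≤ finslerDist F a b := by
  refine le_of_forall_pos_le_add fun ε hε => ?_
  obtain ⟨x, α, β, hαβ, hx, rfl, rfl, hL⟩ := exists_curve_of_finslerDist_lt
    (lt_add_of_pos_right (finslerDist F a b) hε)
  have hy : ContDiff ℝ 1 fun t => x (-t) := hx.comp contDiff_neg
  have h := hF.finslerDist_le_arcLength hy (neg_le_neg hαβ)
  simp only [neg_neg] at h
  refine h.trans (le_trans (le_of_eq ?_) hL.le)
  unfold arcLength
  simp only [deriv_comp_neg, hF.map_neg]
  rw [intervalIntegral.integral_comp_neg fun t => F (x t) (deriv x t)]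
  simp

lemma finslerDist_comm (hF : IsReversibleMetric F) (a b : EuclideanSpace ℝ (Fin n)) :
    finslerDist F a b = finslerDist F b a :=
  (hF.finslerDist_comm_le b a).antisymm (hF.finslerDist_comm_le a b)

lemma finslerDist_le_of_segment (hF : IsReversibleMetric F) {M : ℝ}
    (h : ∀ t ∈ Icc (0 : ℝ) 1, F (a + t • (b - a)) (b - a) ≤ M) : finslerDist F a b ≤ M := by
  have h1 := hF.finslerDist_le_arcLength (contDiff_line a (b - a)) (zero_le_one (α := ℝ))
  have h2 : arcLength F (fun t : ℝ => a + t • (b - a)) 0 1 ≤ ∫ _ in (0 : ℝ)..1, M := by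
    refine intervalIntegral.integral_mono_on zero_le_one
      ((hF.continuous_speed (contDiff_line _ _)).intervalIntegrable _ _) (by simp) fun t ht => ?_
    rw [deriv_line]
    exact h t ht
  simp at h1 h2
  linarith

lemma finslerDist_le_of_closedBall (hF : IsReversibleMetric F) {p : EuclideanSpace ℝ (Fin n)}
    {R C : ℝ} (hC : ∀ q ∈ Metric.closedBall p R, ∀ w, F q w ≤ C * ‖w‖)
    (ha : a ∈ Metric.closedBall p R) (hb : b ∈ Metric.closedBall p R) :
    finslerDist F a b ≤ C * ‖b - a‖ :=
  hF.finslerDist_le_of_segment fun _ ht =>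
    hC _ ((convex_closedBall p R).add_smul_sub_mem ha hb ht) _

lemma tendsto_finslerDist (hF : IsReversibleMetric F) (p : EuclideanSpace ℝ (Fin n)) :
    Tendsto (finslerDist F p) (𝓝 p) (𝓝 0) := by
  obtain ⟨c, -, C, -, h⟩ := hF.exists_bounds p 1
  have h0 : Tendsto (fun q => C * ‖q - p‖) (𝓝 p) (𝓝 0) := by
    have : Continuous fun q => C * ‖q - p‖ := by fun_prop
    simpa using this.tendsto p
  refine squeeze_zero' (.of_forall fun q => hF.finslerDist_nonneg p q) ?_ h0
  filter_upwards [Metric.closedBall_mem_nhds p one_pos] with q hq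
  exact hF.finslerDist_le_of_closedBall (fun q hq w => (h q hq w).2)
    (Metric.mem_closedBall_self zero_le_one) hq

lemma continuous_finslerDist (hF : IsReversibleMetric F) :
    Continuous fun z : EuclideanSpace ℝ (Fin n) × EuclideanSpace ℝ (Fin n) =>
      finslerDist F z.1 z.2 := by
  refine continuous_iff_continuousAt.2 fun ⟨p, q⟩ => ?_
  rw [ContinuousAt, tendsto_iff_dist_tendsto_zero]
  have h1 : Tendsto (fun z : EuclideanSpace ℝ (Fin n) × EuclideanSpace ℝ (Fin n) =>
      finslerDist F p z.1 + finslerDist F q z.2) (𝓝 (p, q)) (𝓝 0) := by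
    simpa using ((hF.tendsto_finslerDist p).comp (continuous_fst.tendsto (p, q))).add
      ((hF.tendsto_finslerDist q).comp (continuous_snd.tendsto (p, q)))
  refine squeeze_zero (fun _ => dist_nonneg) (fun z => ?_) h1
  rw [Real.dist_eq, abs_le]
  have t1 := hF.finslerDist_triangle p z.1 q
  have t2 := hF.finslerDist_triangle z.1 z.2 q
  have t3 := hF.finslerDist_triangle z.1 p z.2
  have t4 := hF.finslerDist_triangle p q z.2
  rw [hF.finslerDist_comm z.2 q] at t2
  rw [hF.finslerDist_comm z.1 p] at t3
  constructor <;> simp only <;> linarith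

/-! ### Lower bounds for lengths and the infinitesimal distance -/

/-- A linear functional below `F` along the curve bounds the arc length from below. -/
lemma le_arcLength_of_le (hF : IsReversibleMetric F) (hx : ContDiff ℝ 1 x) (h : α ≤ β)
    (l : EuclideanSpace ℝ (Fin n) →L[ℝ] ℝ) (hl : ∀ t ∈ Icc α β, ∀ w, l w ≤ F (x t) w) :
    l (x β - x α) ≤ arcLength F x α β := by
  have hc : Continuous fun t => l (deriv x t) := l.continuous.comp (hx.continuous_deriv le_rfl)
  have h1 : ∫ t in α..β, l (deriv x t) = l (x β) - l (x α) :=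
    intervalIntegral.integral_eq_sub_of_hasDerivAt (f := fun t => l (x t))
      (fun t _ => l.hasFDerivAt.comp_hasDerivAt t (hx.differentiable one_ne_zero t).hasDerivAt)
      (hc.intervalIntegrable _ _)
  rw [map_sub, ← h1]
  exact intervalIntegral.integral_mono_on h (hc.intervalIntegrable _ _)
    ((hF.continuous_speed hx).intervalIntegrable _ _) fun t ht => hl t ht _

lemma mul_norm_le_arcLength (hF : IsReversibleMetric F) (hx : ContDiff ℝ 1 x) (h : α ≤ β)
    {c : ℝ} (hc : 0 < c) (hcF : ∀ t ∈ Icc α β, ∀ w, c * ‖w‖ ≤ F (x t) w) :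
    c * ‖x β - x α‖ ≤ arcLength F x α β := by
  obtain ⟨l, hl, hl'⟩ := exists_dual_vector'' ℝ (x β - x α)
  have h1 := hF.le_arcLength_of_le hx h (c • l) fun t ht w => by
    refine le_trans ?_ (hcF t ht w)
    simp only [FunLike.coe_smul, Pi.smul_apply, smul_eq_mul]
    have h2 : l w ≤ ‖w‖ := (le_abs_self _).trans <|
      (l.le_opNorm w).trans (by simpa using mul_le_mul_of_nonneg_right hl (norm_nonneg w))
    exact mul_le_mul_of_nonneg_left h2 hc.le
  simpa [hl'] using h1

/-- Short curves stay near their starting point. -/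
lemma mem_ball_of_arcLength_lt (hF : IsReversibleMetric F) (hx : ContDiff ℝ 1 x)
    {c r : ℝ} (hc : 0 < c) (hcF : ∀ q ∈ Metric.closedBall (x α) r, ∀ w, c * ‖w‖ ≤ F q w)
    (hL : arcLength F x α β < c * r) {t : ℝ} (ht : t ∈ Icc α β) : x t ∈ Metric.ball (x α) r := by
  by_contra hout
  have hdist : Continuous fun s => dist (x s) (x α) := by have := hx.continuous; fun_prop
  have hK : IsCompact (Icc α β ∩ {s | r ≤ dist (x s) (x α)}) :=
    isCompact_Icc.inter_right (isClosed_le continuous_const hdist)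
  -- `τ` is the first time at distance at least `r`; the lower bound for the norm holds up to `τ`
  -- and already forces length `c * r`.
  obtain ⟨τ, ⟨hτ, hτr⟩, hmin⟩ := hK.exists_isLeast
    ⟨t, ht, by simpa using hout⟩
  have hin : ∀ s ∈ Ico α τ, x s ∈ Metric.closedBall (x α) r := fun s hs => by
    by_contra hs'
    have hs'' : r ≤ dist (x s) (x α) := (not_le.1 hs').le
    exact absurd (hmin ⟨⟨hs.1, hs.2.le.trans hτ.2⟩, hs''⟩) (not_le.2 hs.2)
  have hr : 0 < r := by
    have := hF.arcLength_nonneg (x := x) (ht.1.trans ht.2)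
    by_contra hr
    nlinarith
  have hlt : α < τ := hτ.1.lt_of_ne fun h => by
    subst h
    simp only [mem_ofPred_eq, dist_self] at hτr
    linarith
  have hin' : ∀ s ∈ Icc α τ, x s ∈ Metric.closedBall (x α) r := by
    rw [← closure_Ico hlt.ne]
    exact fun s hs => (Metric.isClosed_closedBall.preimage hx.continuous).closure_subset_iff.2
      hin hs
  have h1 := hF.mul_norm_le_arcLength hx hτ.1 hc fun s hs => hcF _ (hin' s hs)
  have h2 := hF.arcLength_nonneg (x := x) hτ.2
  have h3 := hF.arcLength_add hx α τ β
  have h4 := mul_le_mul_of_nonneg_left (show r ≤ ‖x τ - x α‖ by simpa [dist_eq_norm] using hτr) hc.le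
  linarith

lemma norm_le_of_finslerDist_lt (hF : IsReversibleMetric F) {c r : ℝ} (hc : 0 < c)
    (hcF : ∀ q ∈ Metric.closedBall a r, ∀ w, c * ‖w‖ ≤ F q w) (h : finslerDist F a b < c * r) :
    c * ‖b - a‖ ≤ finslerDist F a b := by
  refine le_of_forall_gt_imp_ge_of_dense fun L hL => ?_
  obtain ⟨x, α, β, hαβ, hx, rfl, rfl, hL'⟩ := exists_curve_of_finslerDist_lt (lt_min hL h)
  refine (hF.mul_norm_le_arcLength hx hαβ hc fun t ht => hcF _ ?_).trans
    (hL'.le.trans (min_le_left _ _))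
  exact Metric.ball_subset_closedBall
    (hF.mem_ball_of_arcLength_lt hx hc hcF (hL'.trans_le (min_le_right _ _)) ht)

/-- Infinitesimally, the distance from `a` is given by the norm `F(a, ·)`. -/
lemma eventually_finslerDist_near (hF : IsReversibleMetric F) (a : EuclideanSpace ℝ (Fin n))
    {ε : ℝ} (hε : 0 < ε) (hε1 : ε < 1) :
    ∀ᶠ b in 𝓝 a, (1 - ε) * F a (b - a) ≤ finslerDist F a b ∧
      finslerDist F a b ≤ (1 + ε) * F a (b - a) := by
  obtain ⟨c, hc, C, -, hcC⟩ := hF.exists_bounds a 0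
  have hca : ∀ w, c * ‖w‖ ≤ F a w := fun w => (hcC a (by simp) w).1
  obtain ⟨r, hr, hball⟩ := Metric.nhds_basis_closedBall.eventually_iff.1 (hF.eventually_near a hε)
  have hc' : 0 < (1 - ε) * c := mul_pos (by linarith) hc
  have hcF : ∀ q ∈ Metric.closedBall a r, ∀ w, (1 - ε) * c * ‖w‖ ≤ F q w := fun q hq w =>
    le_trans (by rw [mul_assoc]; exact mul_le_mul_of_nonneg_left (hca w) (by linarith))
      (hball hq w).1
  filter_upwards [Metric.closedBall_mem_nhds a hr,
    (hF.tendsto_finslerDist a).eventually_lt_const (mul_pos hc' hr)] with b hb hlt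
  refine ⟨?_, hF.finslerDist_le_of_segment fun t ht => (hball ?_ _).2⟩
  · rcases eq_or_ne (b - a) 0 with h0 | h0
    · rw [h0, hF.map_zero, mul_zero]
      exact hF.finslerDist_nonneg a b
    obtain ⟨l, hl, hl'⟩ := hF.exists_support a h0
    refine le_of_forall_gt_imp_ge_of_dense fun L hL => ?_
    obtain ⟨x, α, β, hαβ, hx, rfl, rfl, hL'⟩ := exists_curve_of_finslerDist_lt (lt_min hL hlt)
    -- Shrunk by `1 - ε`, the functional supporting `F a` at `b - a` lies below `F q` for all `q` in
    -- the ball that contains the curve.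
    have h1 := hF.le_arcLength_of_le hx hαβ ((1 - ε) • l) fun t ht w => by
      have hin := Metric.ball_subset_closedBall
        (hF.mem_ball_of_arcLength_lt hx hc' hcF (hL'.trans_le (min_le_right _ _)) ht)
      exact (mul_le_mul_of_nonneg_left (hl' w) (by linarith)).trans (hball hin w).1
    simp only [FunLike.coe_smul, Pi.smul_apply, smul_eq_mul, hl] at h1
    exact h1.trans (hL'.le.trans (min_le_left _ _))
  · exact (convex_closedBall a r).add_smul_sub_mem (Metric.mem_closedBall_self hr.le) hb ht

lemma tendsto_finslerDist_div (hF : IsReversibleMetric F) (a v : EuclideanSpace ℝ (Fin n)) :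
    Tendsto (fun h : ℝ => finslerDist F a (a + h • v) / h) (𝓝[>] 0) (𝓝 (F a v)) := by
  rw [Metric.tendsto_nhds]
  intro δ hδ
  obtain ⟨ε, hε, hε1, hεδ⟩ : ∃ ε > 0, ε < 1 ∧ ε * F a v < δ := by
    have hv := hF.nonneg a v
    refine ⟨min (1 / 2) (δ / (2 * (F a v + 1))), by positivity,
      (min_le_left _ _).trans_lt (by norm_num), ?_⟩
    calc _ ≤ δ / (2 * (F a v + 1)) * F a v := mul_le_mul_of_nonneg_right (min_le_right _ _) hv
      _ < δ := by rw [div_mul_eq_mul_div, div_lt_iff₀ (by positivity)]; nlinarith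
  have hcont : Tendsto (fun h : ℝ => a + h • v) (𝓝[>] 0) (𝓝 a) := by
    have : Continuous fun h : ℝ => a + h • v := by fun_prop
    simpa using (this.tendsto 0).mono_left nhdsWithin_le_nhds
  filter_upwards [hcont.eventually (hF.eventually_finslerDist_near a hε hε1), self_mem_nhdsWithin]
    with h hh (h0 : 0 < h)
  rw [add_sub_cancel_left, hF.homogeneous, abs_of_pos h0] at hh
  have h1 : (1 - ε) * F a v ≤ finslerDist F a (a + h • v) / h := by
    rw [le_div_iff₀ h0]; linarith [hh.1]
  have h2 : finslerDist F a (a + h • v) / h ≤ (1 + ε) * F a v := by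
    rw [div_le_iff₀ h0]; linarith [hh.2]
  rw [Real.dist_eq, abs_lt]
  constructor <;> linarith

/-! ### Existence of minimal geodesics between nearby points -/

/-- A curve from `a` to `b` of length less than `finslerDist F a b + ε`, parametrized by its arc
length on `[0, finslerDist F a b]`. -/
lemma exists_almost_minimal (hF : IsReversibleMetric F) {c r ε : ℝ} (hc : 0 < c) (hε : 0 < ε)
    (hcF : ∀ q ∈ Metric.closedBall a r, ∀ w, c * ‖w‖ ≤ F q w) (h : finslerDist F a b < c * r) :
    ∃ g : ℝ → EuclideanSpace ℝ (Fin n), (∀ t, g t ∈ Metric.closedBall a r) ∧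
      finslerDist F a (g 0) ≤ ε ∧ finslerDist F b (g (finslerDist F a b)) ≤ ε ∧
      ∀ s ∈ Icc 0 (finslerDist F a b), ∀ t ∈ Icc 0 (finslerDist F a b),
        finslerDist F (g s) (g t) ≤ |t - s| := by
  set D := finslerDist F a b
  have hD0 : 0 ≤ D := hF.finslerDist_nonneg a b
  obtain ⟨x, α, β, hαβ, hx, rfl, rfl, hL⟩ := exists_curve_of_finslerDist_lt
    (lt_min (lt_add_of_pos_right D hε) h)
  have hcont : Continuous fun s => arcLength F x α s :=
    intervalIntegral.continuous_primitive
      (fun _ _ => (hF.continuous_speed hx).intervalIntegrable _ _) α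
  -- Outside `[0, D]` the default parameter `α` keeps all values in the ball, as the later
  -- compactness argument in a product over `ℝ` requires.
  have hivt : ∀ t : ℝ, ∃ s ∈ Icc α β, t ∈ Icc 0 D → arcLength F x α s = t := fun t => by
    by_cases ht : t ∈ Icc 0 D
    · have hmem : t ∈ Icc (arcLength F x α α) (arcLength F x α β) :=
        ⟨by simpa [arcLength] using ht.1, ht.2.trans (hF.finslerDist_le_arcLength hx hαβ)⟩
      obtain ⟨s, hs, hst⟩ := intermediate_value_Icc hαβ hcont.continuousOn hmem
      exact ⟨s, hs, fun _ => hst⟩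
    · exact ⟨α, left_mem_Icc.2 hαβ, fun h => absurd h ht⟩
  choose σ hσ hσ' using hivt
  have hle : ∀ s ∈ Icc 0 D, ∀ t ∈ Icc 0 D, σ s ≤ σ t →
      finslerDist F (x (σ s)) (x (σ t)) ≤ |t - s| := fun s hs t ht hst => by
    have h1 := hF.finslerDist_le_arcLength hx hst
    have h2 := hF.arcLength_add hx α (σ s) (σ t)
    rw [hσ' s hs, hσ' t ht] at h2
    exact h1.trans ((by linarith : _ ≤ t - s).trans (le_abs_self _))
  refine ⟨fun t => x (σ t), fun t => ?_, ?_, ?_, fun s hs t ht => ?_⟩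
  · exact Metric.ball_subset_closedBall
      (hF.mem_ball_of_arcLength_lt hx hc hcF (hL.trans_le (min_le_right _ _)) (hσ t))
  · have h1 := hF.finslerDist_le_arcLength hx (hσ 0).1
    rw [hσ' 0 (left_mem_Icc.2 hD0)] at h1
    exact h1.trans hε.le
  · have h1 := hF.finslerDist_le_arcLength hx (hσ D).2
    have h2 := hF.arcLength_add hx α (σ D) β
    rw [hσ' D (right_mem_Icc.2 hD0)] at h2
    rw [hF.finslerDist_comm]
    have h3 := hL.trans_le (min_le_left _ _)
    linarith
  · rcases le_total (σ s) (σ t) with hst | hst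
    · exact hle s hs t ht hst
    · rw [hF.finslerDist_comm, abs_sub_comm]
      exact hle t ht s hs hst

/-- Sufficiently close points are joined by a minimal geodesic. -/
lemma exists_minimal_geodesic (hF : IsReversibleMetric F) (p : EuclideanSpace ℝ (Fin n)) :
    ∃ η > 0, ∀ a ∈ Metric.ball p η, ∀ b ∈ Metric.ball p η,
      ∃ g : ℝ → EuclideanSpace ℝ (Fin n), ContinuousOn g (Icc 0 (finslerDist F a b)) ∧
        g 0 = a ∧ g (finslerDist F a b) = b ∧
        ∀ s ∈ Icc 0 (finslerDist F a b), ∀ t ∈ Icc 0 (finslerDist F a b),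
          finslerDist F (g s) (g t) = |t - s| := by
  obtain ⟨c, hc, C, hC, hcC⟩ := hF.exists_bounds p 3
  have hcF : ∀ a ∈ Metric.closedBall p 2, ∀ q ∈ Metric.closedBall a 1, ∀ w, c * ‖w‖ ≤ F q w :=
    fun a ha q hq w => (hcC q (Metric.closedBall_subset_closedBall' (by
      rw [Metric.mem_closedBall] at ha; linarith) hq) w).1
  have heq : ∀ a ∈ Metric.closedBall p 2, ∀ q, finslerDist F a q ≤ 0 → q = a := fun a ha q hq => by
    have h1 := hF.norm_le_of_finslerDist_lt hc (hcF a ha) (b := q) (by linarith)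
    have h2 : ‖q - a‖ ≤ 0 := by
      by_contra h; push Not at h; nlinarith [mul_pos hc h]
    exact sub_eq_zero.1 (norm_le_zero_iff.1 h2)
  -- Then `C * ‖b - a‖ < c`, so nearly minimal curves stay in the unit ball about `a`, where the
  -- lower bound `c` applies.
  refine ⟨min 1 (c / (2 * C)), by positivity, fun a ha b hb => ?_⟩
  have hsub : Metric.ball p (min 1 (c / (2 * C))) ⊆ Metric.closedBall p 1 :=
    Metric.ball_subset_closedBall.trans (Metric.closedBall_subset_closedBall (min_le_left _ _))
  have ha1 := hsub ha
  have hb1 := hsub hb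
  have h12 : Metric.closedBall p 1 ⊆ Metric.closedBall p 2 :=
    Metric.closedBall_subset_closedBall (by norm_num)
  have h13 : Metric.closedBall p 1 ⊆ Metric.closedBall p 3 :=
    Metric.closedBall_subset_closedBall (by norm_num)
  have hlt : finslerDist F a b < c * 1 := by
    refine (hF.finslerDist_le_of_closedBall (fun q hq w => (hcC q hq w).2)
      (h13 ha1) (h13 hb1)).trans_lt ?_
    have h1 : ‖b - a‖ < c / (2 * C) + c / (2 * C) := by
      rw [← dist_eq_norm]
      refine (dist_triangle_right b a p).trans_lt (add_lt_add ?_ ?_)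
      · exact (Metric.mem_ball.1 hb).trans_le (min_le_right _ _)
      · exact (Metric.mem_ball.1 ha).trans_le (min_le_right _ _)
    calc C * ‖b - a‖ < C * (c / (2 * C) + c / (2 * C)) := mul_lt_mul_of_pos_left h1 hC
      _ = c * 1 := by field_simp; ring
  set D := finslerDist F a b
  have hD0 : 0 ≤ D := hF.finslerDist_nonneg a b
  have hKp : Metric.closedBall a 1 ⊆ Metric.closedBall p 2 :=
    Metric.closedBall_subset_closedBall' (by rw [Metric.mem_closedBall] at ha1; linarith)
  -- Decreasing closed sets of almost minimal maps, in a product of balls that is compact by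
  -- Tychonoff. A common point is a 1-Lipschitz map from `a` to `b`.
  let S : ℕ → Set (ℝ → EuclideanSpace ℝ (Fin n)) := fun k =>
    {g | g ∈ univ.pi (fun _ => Metric.closedBall a 1)} ∩
      ({g | finslerDist F a (g 0) ≤ 1 / ((k : ℝ) + 1)} ∩
      ({g | finslerDist F b (g D) ≤ 1 / ((k : ℝ) + 1)} ∩
      ⋂ s ∈ Icc 0 D, ⋂ t ∈ Icc 0 D, {g | finslerDist F (g s) (g t) ≤ |t - s|}))
  have hpi : IsCompact (univ.pi fun _ : ℝ => Metric.closedBall a 1) :=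
    isCompact_univ_pi fun _ => isCompact_closedBall a 1
  have hclosed : ∀ k, IsClosed (S k) := fun k => by
    have hc2 : ∀ {f g : (ℝ → EuclideanSpace ℝ (Fin n)) → EuclideanSpace ℝ (Fin n)},
        Continuous f → Continuous g → Continuous fun u => finslerDist F (f u) (g u) :=
      fun hf hg => hF.continuous_finslerDist.comp (hf.prodMk hg)
    refine hpi.isClosed.inter ((isClosed_le (hc2 continuous_const (continuous_apply _))
      continuous_const).inter ((isClosed_le (hc2 continuous_const (continuous_apply _))
      continuous_const).inter ?_))
    exact isClosed_biInter fun s _ => isClosed_biInter fun t _ =>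
      isClosed_le (hc2 (continuous_apply _) (continuous_apply _)) continuous_const
  have hne : (⋂ k, S k).Nonempty := by
    refine IsCompact.nonempty_iInter_of_sequence_nonempty_isCompact_isClosed S (fun k => ?_)
      (fun k => ?_) (hpi.of_isClosed_subset (hclosed 0) inter_subset_left) hclosed
    · have hk : 1 / (((k + 1 : ℕ) : ℝ) + 1) ≤ 1 / ((k : ℝ) + 1) := by
        push_cast
        exact one_div_le_one_div_of_le (by positivity) (by linarith)
      exact fun g ⟨h1, h2, h3, h4⟩ => ⟨h1, le_trans h2 hk, le_trans h3 hk, h4⟩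
    · obtain ⟨g, h1, h2, h3, h4⟩ := hF.exists_almost_minimal hc
        (show 0 < 1 / ((k : ℝ) + 1) by positivity) (hcF a (h12 ha1)) hlt
      exact ⟨g, fun t _ => h1 t, h2, h3, mem_iInter₂.2 fun s hs => mem_iInter₂.2 fun t ht =>
        h4 s hs t ht⟩
  obtain ⟨g, hg⟩ := hne
  rw [mem_iInter] at hg
  have hlim := tendsto_one_div_add_atTop_nhds_zero_nat (𝕜 := ℝ)
  have hg0 : g 0 = a := heq a (h12 ha1) _ (ge_of_tendsto' hlim fun k => (hg k).2.1)
  have hgD : g D = b := heq b (h12 hb1) _ (ge_of_tendsto' hlim fun k => (hg k).2.2.1)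
  have hgle : ∀ s ∈ Icc 0 D, ∀ t ∈ Icc 0 D, finslerDist F (g s) (g t) ≤ |t - s| :=
    fun s hs t ht => mem_iInter₂.1 (mem_iInter₂.1 (hg 0).2.2.2 s hs) t ht
  have hgK : ∀ t, g t ∈ Metric.closedBall p 2 := fun t => hKp ((hg 0).1 t trivial)
  -- The upper bounds on `[0, s]`, `[s, t]` and `[t, D]` add up to exactly `D`, so the triangle
  -- inequality forces equality in each.
  have hge : ∀ s ∈ Icc 0 D, ∀ t ∈ Icc 0 D, s ≤ t → finslerDist F (g s) (g t) = |t - s| :=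
    fun s hs t ht hst => by
      refine (hgle s hs t ht).antisymm ?_
      have h1 := hgle 0 (left_mem_Icc.2 hD0) s hs
      have h2 := hgle t ht D (right_mem_Icc.2 hD0)
      have h3 := hF.finslerDist_triangle a (g s) b
      have h4 := hF.finslerDist_triangle (g s) (g t) b
      rw [hg0, sub_zero, abs_of_nonneg hs.1] at h1
      rw [hgD, abs_of_nonneg (by linarith [ht.2])] at h2
      rw [abs_of_nonneg (by linarith)]
      linarith
  refine ⟨g, fun t ht => ?_, hg0, hgD, fun s hs t ht => ?_⟩
  · rw [ContinuousWithinAt, tendsto_iff_norm_sub_tendsto_zero]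
    have hcont : Continuous fun s : ℝ => |s - t| / c := by fun_prop
    have h0 : Tendsto (fun s : ℝ => |s - t| / c) (𝓝[Icc 0 D] t) (𝓝 0) := by
      simpa using (hcont.tendsto t).mono_left nhdsWithin_le_nhds
    refine squeeze_zero' (.of_forall fun _ => norm_nonneg _) ?_ h0
    filter_upwards [self_mem_nhdsWithin, h0.eventually_lt_const one_pos] with s hs hsc
    rw [div_lt_one hc] at hsc
    have h1 := hgle t ht s hs
    have h2 := hF.norm_le_of_finslerDist_lt hc (hcF _ (hgK t)) (b := g s) (by linarith)
    rw [le_div_iff₀ hc]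
    linarith
  · rcases le_total s t with hst | hst
    · exact hge s hs t ht hst
    · rw [hF.finslerDist_comm, abs_sub_comm]
      exact hge t ht s hs hst

/-! ### Consequences of straight geodesics and symmetric spheres -/

lemma exists_midpoint_additive (hF : IsReversibleMetric F) (hflat : IsProjectivelyFlat F)
    (p : EuclideanSpace ℝ (Fin n)) :
    ∃ η > 0, ∀ a ∈ Metric.ball p η, ∀ b ∈ Metric.ball p η,
      finslerDist F a b =
        finslerDist F a (midpoint ℝ a b) + finslerDist F (midpoint ℝ a b) b := by
  obtain ⟨η, hη, H⟩ := hF.exists_minimal_geodesic p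
  refine ⟨η, hη, fun a ha b hb => ?_⟩
  rcases eq_or_ne a b with rfl | hab
  · simp [hF.finslerDist_self]
  obtain ⟨g, hg, hg0, hgD, hgeo⟩ := H a ha b hb
  set D := finslerDist F a b
  have hD0 : 0 ≤ D := hF.finslerDist_nonneg a b
  have hcol := hflat g (Icc 0 D) ⟨ordConnected_Icc, fun t _ => ⟨1, one_pos, fun t₁ h₁ t₂ h₂ =>
    hgeo t₁ h₁.1 t₂ h₂.1⟩⟩
  obtain ⟨v, hv⟩ := (collinear_iff_of_mem (show a ∈ g '' Icc 0 D from
    ⟨0, left_mem_Icc.2 hD0, hg0⟩)).1 hcol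
  obtain ⟨β, hβ⟩ := hv b ⟨D, right_mem_Icc.2 hD0, hgD⟩
  simp only [vadd_eq_add] at hv hβ
  have hβ0 : β ≠ 0 := by rintro rfl; simp at hβ; exact hab hβ.symm
  have hv0 : v ≠ 0 := by rintro rfl; simp at hβ; exact hab hβ.symm
  have hvv : inner ℝ v v ≠ 0 := inner_self_ne_zero.2 hv0
  -- The affine coordinate on the line, `0` at `a` and `1` at `b`; by continuity it takes the value
  -- `1 / 2` on the geodesic.
  let u : ℝ → ℝ := fun t => inner ℝ v (g t - a) / inner ℝ v v / β
  have hu : ContinuousOn u (Icc 0 D) :=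
    ((continuousOn_const.inner (hg.sub continuousOn_const)).div_const _).div_const _
  have hgu : ∀ t ∈ Icc 0 D, g t = (u t * β) • v + a := fun t ht => by
    obtain ⟨r, hr⟩ := hv (g t) ⟨t, ht, rfl⟩
    have : u t * β = r := by
      simp only [u, hr, add_sub_cancel_right, inner_smul_right]
      field_simp
    rw [this, hr]
  obtain ⟨t, ht, hut⟩ := intermediate_value_Icc hD0 hu (show (1 / 2 : ℝ) ∈ _ by
    have h0 : u 0 = 0 := by simp [u, hg0]
    have h1 : u D = 1 := by
      simp only [u, hgD, hβ, add_sub_cancel_right, inner_smul_right]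
      field_simp
    rw [h0, h1]; constructor <;> norm_num)
  have hm : midpoint ℝ a b = g t := by
    rw [hgu t ht, hut, hβ, midpoint_eq_smul_add]
    simp only [invOf_eq_inv]
    module
  have h1 := hgeo 0 (left_mem_Icc.2 hD0) t ht
  have h2 := hgeo t ht D (right_mem_Icc.2 hD0)
  rw [hg0, sub_zero, abs_of_nonneg ht.1] at h1
  rw [hgD, abs_of_nonneg (by linarith [ht.2])] at h2
  rw [hm, h1, h2]
  ring

lemma finslerDist_pointReflection (hF : IsReversibleMetric F) (hsymm : HasSymmetricSpheres F)
    (m q : EuclideanSpace ℝ (Fin n)) :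
    finslerDist F m (Equiv.pointReflection m q) = finslerDist F m q := by
  have key : ∀ q, 0 < finslerDist F m q →
      finslerDist F m (Equiv.pointReflection m q) = finslerDist F m q := fun q hq => by
    have h : Equiv.pointReflection m q ∈ geodesicSphere F m (finslerDist F m q) := by
      rw [← hsymm m _ hq]
      exact mem_image_of_mem _ rfl
    exact h
  -- The symmetry concerns positive radii only. At distance `0` from `m`, it is applied to the
  -- reflected point if that one has positive distance.
  rcases (hF.finslerDist_nonneg m q).eq_or_lt with h0 | h0
  · rcases (hF.finslerDist_nonneg m (Equiv.pointReflection m q)).eq_or_lt with h1 | h1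
    · rw [← h0, ← h1]
    · rw [← key _ h1, Equiv.pointReflection_involutive m q]
  · exact key q h0

/-- Locally, the distance of `a` and `b` is the length `F(a, b - a)` of the vector `b - a`. -/
lemma exists_finslerDist_eq (hF : IsReversibleMetric F) (hflat : IsProjectivelyFlat F)
    (hsymm : HasSymmetricSpheres F) (p : EuclideanSpace ℝ (Fin n)) :
    ∃ η > 0, ∀ a ∈ Metric.ball p η, ∀ b ∈ Metric.ball p η, finslerDist F a b = F a (b - a) := by
  obtain ⟨η, hη, H⟩ := hF.exists_midpoint_additive hflat p
  refine ⟨η, hη, fun a ha b hb => ?_⟩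
  have hhalf : ∀ b ∈ Metric.ball p η, finslerDist F a b = 2 * finslerDist F a (midpoint ℝ a b) :=
    fun b hb => by
      have h1 := H a ha b hb
      have h2 := hF.finslerDist_pointReflection hsymm (midpoint ℝ a b) a
      rw [Equiv.pointReflection_midpoint_left, hF.finslerDist_comm _ a] at h2
      linarith
  have hpow : ∀ k : ℕ, finslerDist F a b =
      finslerDist F a (a + ((1 / 2 : ℝ) ^ k) • (b - a)) / (1 / 2) ^ k := fun k => by
    induction k with
    | zero => simp
    | succ k ih =>
      have hmem : a + ((1 / 2 : ℝ) ^ k) • (b - a) ∈ Metric.ball p η :=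
        (convex_ball p η).add_smul_sub_mem ha hb
          ⟨by positivity, pow_le_one₀ (by norm_num) (by norm_num)⟩
      have hm : midpoint ℝ a (a + ((1 / 2 : ℝ) ^ k) • (b - a)) =
          a + ((1 / 2 : ℝ) ^ (k + 1)) • (b - a) := by
        rw [midpoint_eq_smul_add, invOf_eq_inv, pow_succ]
        module
      rw [ih, hhalf _ hmem, hm, pow_succ]
      field_simp
  have h0 : Tendsto (fun k : ℕ => (1 / 2 : ℝ) ^ k) atTop (𝓝[>] 0) :=
    tendsto_nhdsWithin_iff.2 ⟨tendsto_pow_atTop_nhds_zero_of_lt_one (by norm_num) (by norm_num),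
      .of_forall fun k => by simp⟩
  have h1 := (hF.tendsto_finslerDist_div a (b - a)).comp h0
  exact tendsto_nhds_unique (tendsto_const_nhds.congr hpow) h1

/-- The derivative of `F` with respect to the base point vanishes. -/
lemma hasDerivAt_base (hF : IsReversibleMetric F) (hflat : IsProjectivelyFlat F)
    (hsymm : HasSymmetricSpheres F) (p z : EuclideanSpace ℝ (Fin n))
    {y : EuclideanSpace ℝ (Fin n)} (hy : y ≠ 0) :
    HasDerivAt (fun t : ℝ => F (p + t • z) y) 0 0 := by
  obtain ⟨η, hη, H⟩ := hF.exists_finslerDist_eq hflat hsymm p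
  have hcont : ∀ w : EuclideanSpace ℝ (Fin n),
      ∀ᶠ t : ℝ in 𝓝 0, p + t • w ∈ Metric.ball p η := fun w => by
    have : Continuous fun t : ℝ => p + t • w := by fun_prop
    exact this.continuousAt.eventually_mem (by simpa using Metric.ball_mem_nhds p hη)
  obtain ⟨s, hs, hs0⟩ := (((hcont y).and (hcont (-y))).filter_mono
    (nhdsWithin_le_nhds (s := Ioi 0))).and self_mem_nhdsWithin |>.exists
  replace hs0 : 0 < s := hs0
  have hsy : s • y ≠ 0 := smul_ne_zero hs0.ne' hy
  have hD := ((hF.contDiffAt p hsy).differentiableAt (by simp)).hasFDerivAt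
  set D := fderiv ℝ (Function.uncurry F) (p, s • y)
  have hcurve : ∀ w : EuclideanSpace ℝ (Fin n),
      HasDerivAt (fun t : ℝ => F (p + t • z) (s • y + t • w)) (D (z, w)) 0 := fun w => by
    have hl : ∀ q u : EuclideanSpace ℝ (Fin n), HasDerivAt (fun t : ℝ => q + t • u) u 0 :=
      fun q u => by simpa using ((hasDerivAt_id (0 : ℝ)).smul_const u).const_add q
    have h := (hl p z).prodMk (hl (s • y) w)
    have hD0 : HasFDerivAt (Function.uncurry F) D (p + (0 : ℝ) • z, s • y + (0 : ℝ) • w) := by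
      simpa using hD
    exact hD0.comp_hasDerivAt 0 h
  -- At `t = 0` the sum is `2 * F p (s • y)`, the distance between `p - s • y` and `p + s • y`. For
  -- other `t` it is the length of the detour through `p + t • z`.
  have hmin : IsLocalMin (fun t : ℝ => F (p + t • z) (s • y + t • z) +
      F (p + t • z) (s • y + t • (-z))) 0 := by
    filter_upwards [hcont z] with t ht
    have hp : p ∈ Metric.ball p η := Metric.mem_ball_self hη
    have ha := hs.2
    have hb := hs.1
    have t1 := hF.finslerDist_triangle (p + s • -y) (p + t • z) (p + s • y)
    rw [hF.finslerDist_comm _ (p + t • z), H _ ht _ ha, H _ ht _ hb, H _ ha _ hb] at t1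
    -- The local formula and the symmetry of the distance give the vector `s • y` the same norm at
    -- `p - s • y` as at `p`.
    have e1 : F (p + s • -y) (p + s • y - (p + s • -y)) = 2 * F p (s • y) := by
      have h1 := H _ ha _ hp
      have h2 := H _ hp _ ha
      rw [hF.finslerDist_comm, h2] at h1
      have e2 : p + s • y - (p + s • -y) = (2 : ℝ) • (p - (p + s • -y)) := by module
      have e3 : p + s • -y - p = -(s • y) := by module
      rw [e2, hF.homogeneous, ← h1, e3, hF.map_neg]
      norm_num
    have e4 : p + s • -y - (p + t • z) = -(s • y + t • z) := by module
    have e5 : p + s • y - (p + t • z) = s • y + t • (-z) := by module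
    rw [e1, e4, e5, hF.map_neg] at t1
    simp only [zero_smul, add_zero]
    linarith
  have h0 := hmin.hasDerivAt_eq_zero ((hcurve z).add (hcurve (-z)))
  have h1 : D (z, 0) = 0 := by
    rw [← map_add] at h0
    have : (z, z) + (z, -z) = (2 : ℝ) • (z, (0 : EuclideanSpace ℝ (Fin n))) := by
      ext <;> simp [two_mul]
    rw [this, map_smul] at h0
    simpa using h0
  have h2 := hcurve 0
  rw [h1] at h2
  -- Homogeneity removes the factor `s` that was needed to stay near `p`.
  simp only [smul_zero, add_zero, hF.homogeneous, abs_of_pos hs0] at h2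
  have h3 := h2.const_mul s⁻¹
  simpa [inv_mul_cancel_left₀ hs0.ne'] using h3

end IsReversibleMetric

end Finsler

theorem mainTheorem8 (n : ℕ)
    (F : EuclideanSpace ℝ (Fin n) → EuclideanSpace ℝ (Fin n) → ℝ)
    (hF : Finsler.IsReversibleMetric F)
    (hflat : Finsler.IsProjectivelyFlat F)
    (hsymm : Finsler.HasSymmetricSpheres F) :
    Finsler.IsMinkowskiSpace F := by
  refine ⟨hF, fun p q y => ?_⟩
  rcases eq_or_ne y 0 with rfl | hy
  · rw [hF.map_zero, hF.map_zero]
  have hd : ∀ t : ℝ, HasDerivAt (fun t : ℝ => F (p + t • (q - p)) y) 0 t := fun t => by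
    have h := hF.hasDerivAt_base hflat hsymm (p + t • (q - p)) (q - p) hy
    have h2 : HasDerivAt (fun u : ℝ => F (p + t • (q - p) + (u - t) • (q - p)) y) 0 t := by
      simpa using HasDerivAt.comp_sub_const t t (by simpa using h)
    refine h2.congr_of_eventuallyEq (.of_forall fun u => ?_)
    simp only
    congr 1
    module
  have h := is_const_of_deriv_eq_zero (fun t => (hd t).differentiableAt) (fun t => (hd t).deriv) 0 1
  simpa using h
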